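/- For $k\in\mathbb R$ and $x\in(0,\infty)$ put $u_0^k=1$, $u_1^k=x^k$, $u_2^k=x^{k-1}$, $u_3^k=x^{k-2}$, $u_4^k=x^{2k-1}$, $u_5^k=x^{2k-2}$, $u_6^k=x^{3k-2}$, $u_7^k=x^{3k-3}$, $u_8^k=x+x^{2k-1}$, $u_9^k=x+kx^{4k-3}$, $u_{10}^k=(1+x^{2k-2})(x+kx^{2k-1})$, $u_{11}^k=(x+x^{2k-1})\arctan(x^{k-1})$, $u_{12}^k=(1+x^{2k-2})(x+kx^{2k-1})\arctan(x^{k-1})$, $u_{13}^k=x^{2k}$, and consider the ordered families $\mathcal G_0^k=[u_1^k]$, $\mathcal G_1^k=[u_0^k,u_1^k]$, $\mathcal G_2^k=[u_8^k,u_{11}^k,u_1^k]$, $\mathcal G_3^k=[u_0^k,u_2^k,u_8^k]$, $\mathcal G_4^k=[u_{11}^k,u_8^k,u_1^k,u_2^k]$, $\mathcal G_5^k=[u_2^k,u_5^k,u_4^k,u_0^k,u_1^k,u_6^k,u_7^k,u_9^k]$, $\mathcal G_6^k=[u_6^k,u_0^k,u_1^k,u_{10}^k,u_{12}^k]$, $\mathcal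 G_7^k=[u_5^k,u_6^k,u_3^k,u_1^k,u_{10}^k,u_{12}^k]$, $\mathcal G_{10}^k=[u_0^k,u_1^k,u_{13}^k]$, $\mathcal G_{11}^k=[u_1^k,u_3^k]$. For a finite family $\mathcal F$ of smooth functions on $(0,\infty)$ let $\mathcal Z(\mathcal F)$ be the maximum, over all real linear combinations $f$ of members of $\mathcal F$, of the number of isolated zeros of $f$ in $(0,\infty)$, counted with multiplicity. In each of the following cases the maximum exists and has the stated value: 1. $\mathcal Z(\mathcal G_0^k)=0$ for $k>0$; 2. $\mathcal Z(\mathcal G_1^k)=1$ for $k>0$; 3. $\mathcal Z(\mathcal G_2^k)=2$ for $k\neq1$; 4. $\mathcal Z(\mathcal G_3^k)=2$ for $k\in(1,2]$; 5. $\mathcal Z(\mathcal G_3^k)=3$ for $k\in(2,\infty)$; 6. $\mathcal Z(\mathcal G_4^k)=3$ for $k\in(1,\tfrac32]\cup[2,\infty)$; 7. $\mathcal Z(\mathcal G_4^k)=4$ for $k\in(0,\tfrac12)\cup(\tfrac32,2)$; 8. $\mathcal Z(\mathcal G_5^k)=7$ for $k\in[\tfrac43,\tfrac32)\cup(2,\infty)$;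 9. $\mathcal Z(\mathcal G_5^k)=8$ for $k\in(1,\tfrac43)\cup(\tfrac32,2)$; 10. $\mathcal Z(\mathcal G_6^k)=4$ for $k=2$; 11. $\mathcal Z(\mathcal G_7^k)=5$ for $k=\tfrac23$; 12. $\mathcal Z(\mathcal G_{10}^k)=2$ for $k>0$; 13. $\mathcal Z(\mathcal G_{11}^k)=1$ for $k=1$. -/

import Mathlib

open scoped Topology

noncomputable section

namespace ChebyshevFamilies

/-- The functions `u₀ᵏ, …, u₁₃ᵏ`; only their values on `(0, ∞)` matter. -/
def u0 (_k : ℝ) (_x : ℝ) : ℝ := 1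

def u1 (k : ℝ) (x : ℝ) : ℝ := x ^ k

def u2 (k : ℝ) (x : ℝ) : ℝ := x ^ (k - 1)

def u3 (k : ℝ) (x : ℝ) : ℝ := x ^ (k - 2)

def u4 (k : ℝ) (x : ℝ) : ℝ := x ^ (2 * k - 1)

def u5 (k : ℝ) (x : ℝ) : ℝ := x ^ (2 * k - 2)

def u6 (k : ℝ) (x : ℝ) : ℝ := x ^ (3 * k - 2)

def u7 (k : ℝ) (x : ℝ) : ℝ := x ^ (3 * k - 3)

def u8 (k : ℝ) (x : ℝ) : ℝ := x + x ^ (2 * k - 1)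

def u9 (k : ℝ) (x : ℝ) : ℝ := x + k * x ^ (4 * k - 3)

def u10 (k : ℝ) (x : ℝ) : ℝ := (1 + x ^ (2 * k - 2)) * (x + k * x ^ (2 * k - 1))

def u11 (k : ℝ) (x : ℝ) : ℝ := (x + x ^ (2 * k - 1)) * Real.arctan (x ^ (k - 1))

def u12 (k : ℝ) (x : ℝ) : ℝ :=
  (1 + x ^ (2 * k - 2)) * (x + k * x ^ (2 * k - 1)) * Real.arctan (x ^ (k - 1))

def u13 (k : ℝ) (x : ℝ) : ℝ := x ^ (2 * k)

/-- The ordered families. -/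
def G0 (k : ℝ) : Fin 1 → ℝ → ℝ := ![u1 k]

def G1 (k : ℝ) : Fin 2 → ℝ → ℝ := ![u0 k, u1 k]

def G2 (k : ℝ) : Fin 3 → ℝ → ℝ := ![u8 k, u11 k, u1 k]

def G3 (k : ℝ) : Fin 3 → ℝ → ℝ := ![u0 k, u2 k, u8 k]

def G4 (k : ℝ) : Fin 4 → ℝ → ℝ := ![u11 k, u8 k, u1 k, u2 k]

def G5 (k : ℝ) : Fin 8 → ℝ → ℝ := ![u2 k, u5 k, u4 k, u0 k, u1 k, u6 k, u7 k, u9 k]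

def G6 (k : ℝ) : Fin 5 → ℝ → ℝ := ![u6 k, u0 k, u1 k, u10 k, u12 k]

def G7 (k : ℝ) : Fin 6 → ℝ → ℝ := ![u5 k, u6 k, u3 k, u1 k, u10 k, u12 k]

def G10 (k : ℝ) : Fin 3 → ℝ → ℝ := ![u0 k, u1 k, u13 k]

def G11 (k : ℝ) : Fin 2 → ℝ → ℝ := ![u1 k, u3 k]

/-- `x` is an isolated zero of `f` in `(0, ∞)`. -/
def IsIsolatedZero (f : ℝ → ℝ) (x : ℝ) : Prop :=
  0 < x ∧ f x = 0 ∧ ∀ᶠ y in 𝓝[≠] x, f y ≠ 0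

/-- The multiplicity of `x` as a zero of the smooth function `f`: the least order of a derivative
of `f` that does not vanish at `x` (`⊤` if there is none). -/
def zeroMultiplicity (f : ℝ → ℝ) (x : ℝ) : ℕ∞ :=
  ⨅ (i : ℕ) (_ : iteratedDeriv i f x ≠ 0), (i : ℕ∞)

/-- The number of isolated zeros of `f` in `(0, ∞)`, counted with multiplicity. -/
def zeroCount (f : ℝ → ℝ) : ℕ∞ :=
  ⨆ (S : Finset ℝ) (_ : ∀ x ∈ S, IsIsolatedZero f x), ∑ x ∈ S, zeroMultiplicity f x

/-- `𝒵(F) = N`: the maximum, over the real linear combinations of the members of `F`, of the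
number of isolated zeros in `(0, ∞)` counted with multiplicity exists and equals `N`. -/
def MaxZerosEq {n : ℕ} (F : Fin n → ℝ → ℝ) (N : ℕ) : Prop :=
  IsGreatest (zeroCount '' (Submodule.span ℝ (Set.range F) : Set (ℝ → ℝ))) (N : ℕ∞)

end ChebyshevFamilies

end

noncomputable section

namespace ChebyshevFamilies

/-! ### Counting zeros of analytic functions on the real line -/

/-! With `x = exp t`, powers become exponentials, and zeros keep their multiplicities because `exp`
is a local diffeomorphism. Rolle's theorem with multiplicities (`ZerosLE.of_deriv`) says that
dividing by a nowhere vanishing function and then differentiating loses at most one zero. Hence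
upper bounds come from reducing a combination, in as many steps as possible, to a function whose
zeros are evident; `Reduces` records such a reduction.

For lower bounds, `n + 1` coefficients can meet `n` linear conditions, so some nontrivial
combination of `n + 1` functions vanishes to order `n` at a given point
(`exists_le_analyticOrderAt`). If all combinations reduce, in `n` steps, to multiples of one
function with a zero `t`, a combination vanishing to order `n` at `t` in fact vanishes to order `n +
1` there. This is the source of the values exceeding the number of functions minus one.

For `G3`, `G4` and `G5` the last function of the reduction is a sum of two exponentials, and the
signs of its coefficients separate the ranges of `k`. For `G6` and `G7`, dividing by `u10` and
differentiating leaves a polynomial in an exponential. Its coefficients satisfy one linear relation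
with alternating signs, which excludes the maximal number of positive roots (`zerosLE_eval_exp`). -/

/-- `g` has at most `N` zeros on the real line, counted with multiplicity. -/
def ZerosLE (g : ℝ → ℝ) (N : ℕ) : Prop :=
  ∀ S : Finset ℝ, ∑ x ∈ S, analyticOrderAt g x ≤ (N : ℕ∞)

lemma ZerosLE.mono {g : ℝ → ℝ} {M N : ℕ} (h : ZerosLE g M) (hMN : M ≤ N) : ZerosLE g N :=
  fun S => (h S).trans (by exact_mod_cast hMN)

lemma zerosLE_zero_of_ne_zero {g : ℝ → ℝ} (hg : ∀ x, g x ≠ 0) : ZerosLE g 0 := by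
  intro S
  rw [Finset.sum_eq_zero fun x _ => analyticOrderAt_eq_zero.2 (Or.inr (hg x))]
  simp

/-- Rolle's theorem with multiplicities: differentiation loses at most one zero. -/
lemma ZerosLE.of_deriv {g : ℝ → ℝ} (hg : ∀ x, AnalyticAt ℝ g x) {N : ℕ}
    (h : ZerosLE (deriv g) N) : ZerosLE g (N + 1) := by
  classical
  intro S
  set Z := S.filter (fun x => g x = 0) with hZ
  have hsum : ∑ x ∈ S, analyticOrderAt g x = ∑ x ∈ Z, analyticOrderAt g x := by
    rw [hZ, Finset.sum_filter]
    refine Finset.sum_congr rfl fun x _ => ?_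
    split_ifs with hx
    · rfl
    · exact analyticOrderAt_eq_zero.2 (Or.inr hx)
  have hrolle : ∀ p : ℝ × ℝ, ∃ z, p.1 < p.2 → g p.1 = 0 → g p.2 = 0 →
      p.1 < z ∧ z < p.2 ∧ deriv g z = 0 := by
    rintro ⟨x, y⟩
    by_cases hxy : x < y ∧ g x = g y
    · obtain ⟨z, hz, hz'⟩ := exists_deriv_eq_zero hxy.1
        (fun z _ => (hg z).continuousAt.continuousWithinAt) hxy.2
      exact ⟨z, fun _ _ _ => ⟨hz.1, hz.2, hz'⟩⟩
    · exact ⟨0, fun h1 h2 h3 => absurd ⟨h1, h2.trans h3.symm⟩ hxy⟩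
  choose r hr using hrolle
  -- The filter discards the values of `r` at pairs to which Rolle's theorem does not apply. Points
  -- of `T \ Z` are zeros of the derivative not already counted at multiple zeros of `g`.
  set T := ((Z ×ˢ Z).image r).filter (fun x => deriv g x = 0) with hT
  have hcard : Z.card ≤ (T \ Z).card + 1 := by
    refine Finset.card_le_sdiff_of_interleaved fun x hx y hy hxy _ => ?_
    obtain ⟨h1, h2, h3⟩ := hr (x, y) hxy (Finset.mem_filter.1 hx).2 (Finset.mem_filter.1 hy).2
    exact ⟨r (x, y), Finset.mem_filter.2
      ⟨Finset.mem_image.2 ⟨(x, y), Finset.mem_product.2 ⟨hx, hy⟩, rfl⟩, h3⟩, h1, h2⟩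
  have horder : ∀ x ∈ Z, analyticOrderAt g x = analyticOrderAt (deriv g) x + 1 := by
    intro x hx
    have := (hg x).analyticOrderAt_deriv_add_one
    rw [(Finset.mem_filter.1 hx).2] at this
    simpa using this.symm
  have hT1 : ((T \ Z).card : ℕ∞) ≤ ∑ x ∈ T \ Z, analyticOrderAt (deriv g) x := by
    rw [Finset.card_eq_sum_ones, Nat.cast_sum]
    refine Finset.sum_le_sum fun x hx => ?_
    rw [Nat.cast_one, Order.one_le_iff_ne_zero, (hg x).deriv.analyticOrderAt_ne_zero]
    exact (Finset.mem_filter.1 (Finset.mem_sdiff.1 hx).1).2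
  have hcard' : (Z.card : ℕ∞) ≤ (T \ Z).card + 1 := by exact_mod_cast hcard
  rw [hsum, Finset.sum_congr rfl horder, Finset.sum_add_distrib, Finset.sum_const, nsmul_one]
  calc ∑ x ∈ Z, analyticOrderAt (deriv g) x + (Z.card : ℕ∞)
      ≤ ∑ x ∈ Z, analyticOrderAt (deriv g) x
          + (∑ x ∈ T \ Z, analyticOrderAt (deriv g) x + 1) := by
        gcongr
        exact hcard'.trans (by gcongr)
    _ = ∑ x ∈ Z ∪ (T \ Z), analyticOrderAt (deriv g) x + 1 := by
        rw [Finset.sum_union Finset.disjoint_sdiff, add_assoc]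
    _ ≤ ((N + 1 : ℕ) : ℕ∞) := by
        push_cast
        gcongr
        exact h _

/-- `h` arises from `g` by `m` differentiations and by multiplications with units, as far as
the zeros are concerned. -/
structure Reduces (m : ℕ) (g h : ℝ → ℝ) : Prop where
  zerosLE : ∀ N, ZerosLE h N → ZerosLE g (N + m)
  -- The restriction on the order is needed: a derivative may vanish where the function does not.
  order : ∀ x, (m : ℕ∞) ≤ analyticOrderAt g x →
    analyticOrderAt h x + m = analyticOrderAt g x

lemma Reduces.refl (g : ℝ → ℝ) : Reduces 0 g g := ⟨fun _ h => h, fun _ _ => by simp⟩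

lemma Reduces.trans {m n : ℕ} {f g h : ℝ → ℝ} (h₁ : Reduces m f g) (h₂ : Reduces n g h) :
    Reduces (m + n) f h := by
  refine ⟨fun N hN => ?_, fun x hx => ?_⟩
  · have := h₁.zerosLE _ (h₂.zerosLE _ hN)
    rwa [add_assoc, add_comm n m] at this
  · push_cast at hx ⊢
    have e₁ := h₁.order x (le_self_add.trans hx)
    have e₂ : (n : ℕ∞) ≤ analyticOrderAt g x := by
      rw [← e₁, add_comm] at hx
      exact (ENat.add_le_add_iff_right (ENat.natCast_ne_top m)).1 hx
    rw [← e₁, ← h₂.order x e₂, add_assoc, add_comm (n : ℕ∞)]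

lemma Reduces.mul {g h u : ℝ → ℝ} (hh : ∀ x, AnalyticAt ℝ h x) (hu : ∀ x, AnalyticAt ℝ u x)
    (hu₀ : ∀ x, u x ≠ 0) (hgh : ∀ x, g x = u x * h x) : Reduces 0 g h := by
  have key : ∀ x, analyticOrderAt g x = analyticOrderAt h x := by
    intro x
    rw [show g = u * h from funext hgh, analyticOrderAt_mul (hu x) (hh x),
      analyticOrderAt_eq_zero.2 (Or.inr (hu₀ x)), zero_add]
  exact ⟨fun N hN S => by simpa [key] using hN S, fun x _ => by simp [key]⟩

lemma Reduces.of_deriv {g : ℝ → ℝ} (hg : ∀ x, AnalyticAt ℝ g x) : Reduces 1 g (deriv g) := by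
  refine ⟨fun N hN => hN.of_deriv hg, fun x hx => ?_⟩
  have h0 : g x = 0 := apply_eq_zero_of_analyticOrderAt_ne_zero
    (Order.one_le_iff_ne_zero.1 (by simpa using hx))
  have := (hg x).analyticOrderAt_deriv_add_one
  rw [h0] at this
  simpa using this

lemma Reduces.of_hasDerivAt {g h u : ℝ → ℝ} (hg : ∀ x, AnalyticAt ℝ g x)
    (hh : ∀ x, AnalyticAt ℝ h x) (hu : ∀ x, AnalyticAt ℝ u x) (hu₀ : ∀ x, u x ≠ 0)
    (hgh : ∀ x, HasDerivAt g (u x * h x) x) : Reduces 1 g h :=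
  (Reduces.of_deriv hg).trans (Reduces.mul hh hu hu₀ fun x => (hgh x).deriv)

/-! ### Exponential sums -/

/-- The exponential sum `∑ i, cᵢ exp (eᵢ x)`. -/
def expSum {ι : Type*} [Fintype ι] (c e : ι → ℝ) (x : ℝ) : ℝ := ∑ i, c i * Real.exp (e i * x)

section ExpSum

variable {ι : Type*} [Fintype ι]

lemma analyticAt_expSum (c e : ι → ℝ) (x : ℝ) : AnalyticAt ℝ (expSum c e) x := by
  unfold expSum
  fun_prop

/-- Differentiation conjugated by `exp (a x)` is the operator `D - a`, which is diagonal on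
exponentials and kills the exponent `a`. -/
lemma Reduces.expSum_sub (c e : ι → ℝ) (a : ℝ) :
    Reduces 1 (expSum c e) (expSum (fun i => c i * (e i - a)) e) := by
  have h₁ : Reduces 0 (expSum c e) (expSum c fun i => e i - a) := by
    refine Reduces.mul (analyticAt_expSum _ _) (u := fun x => Real.exp (a * x))
      (fun x => by fun_prop) (fun x => (Real.exp_pos _).ne') fun x => ?_
    simp only [expSum, Finset.mul_sum]
    refine Finset.sum_congr rfl fun i _ => ?_
    rw [mul_left_comm, ← Real.exp_add]
    ring_nf
  have h₂ : Reduces 1 (expSum c fun i => e i - a) (expSum (fun i => c i * (e i - a)) e) := by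
    refine Reduces.of_hasDerivAt (analyticAt_expSum _ _) (analyticAt_expSum _ _)
      (u := fun x => Real.exp (-a * x)) (fun x => by fun_prop)
      (fun x => (Real.exp_pos _).ne') fun x => ?_
    unfold expSum
    rw [Finset.mul_sum]
    refine HasDerivAt.fun_sum fun i _ => ?_
    have h := (((hasDerivAt_id x).const_mul (e i - a)).exp).const_mul (c i)
    refine h.congr_deriv ?_
    have : Real.exp ((e i - a) * x) = Real.exp (-a * x) * Real.exp (e i * x) := by
      rw [← Real.exp_add]
      ring_nf
    simp only [id, this]
    ring
  simpa using h₁.trans h₂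

lemma Reduces.expSum_prod (c e : ι → ℝ) (L : List ℝ) :
    Reduces L.length (expSum c e) (expSum (fun i => c i * (L.map fun a => e i - a).prod) e) := by
  induction L generalizing c with
  | nil => simpa using Reduces.refl (expSum c e)
  | cons a L ih =>
    have := (Reduces.expSum_sub c e a).trans (ih _)
    simpa [add_comm, mul_assoc] using this

/-- Choose an exponent with nonzero coefficient and kill all the others by operators `D - a`: one
exponential without zeros remains. -/
lemma zerosLE_expSum {n : ℕ} (hn : Fintype.card ι ≤ n + 1) {c e : ι → ℝ}
    (he : Function.Injective e) (hc : c ≠ 0) : ZerosLE (expSum c e) n := by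
  classical
  obtain ⟨i, hi⟩ := Function.ne_iff.1 hc
  set L := ((Finset.univ.erase i).toList).map e with hL
  have hlen : L.length ≤ n := by
    simp [hL]
    omega
  refine ZerosLE.mono ?_ hlen
  have := (Reduces.expSum_prod c e L).zerosLE 0 ?_
  · simpa using this
  · refine zerosLE_zero_of_ne_zero fun x => ?_
    unfold expSum
    rw [Finset.sum_eq_single i]
    · refine mul_ne_zero (mul_ne_zero hi ?_) (Real.exp_pos _).ne'
      rw [Ne, List.prod_eq_zero_iff]
      simp only [hL, List.map_map, List.mem_map, Finset.mem_toList, Finset.mem_erase,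
        Function.comp_apply, not_exists, not_and]
      intro j hj h
      exact hj.1 (he (by linarith)).symm
    · intro j _ hj
      have : (L.map fun a => e j - a).prod = 0 := by
        rw [List.prod_eq_zero_iff]
        simp only [hL, List.map_map, List.mem_map, Finset.mem_toList, Finset.mem_erase,
          Function.comp_apply]
        exact ⟨j, ⟨hj, Finset.mem_univ _⟩, sub_self _⟩
      simp [this]
    · simp

end ExpSum

/-- A sum of exponentials with distinct exponents `eᵢ`, to which a multiple of
`α exp (u x) + β exp (w x)` is added. -/
lemma Reduces.expSum_add {n : ℕ} (e c : Fin n → ℝ) (d α β u w : ℝ) :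
    Reduces n (fun x => ∑ i, c i * Real.exp (e i * x) +
        d * (α * Real.exp (u * x) + β * Real.exp (w * x)))
      (fun x => d * (α * (∏ i, (u - e i)) * Real.exp (u * x) +
        β * (∏ i, (w - e i)) * Real.exp (w * x))) := by
  have h := Reduces.expSum_prod (ι := Fin n ⊕ Fin 2) (Sum.elim c ![d * α, d * β])
    (Sum.elim e ![u, w]) (List.ofFn e)
  -- The operator is the product of all `D - eᵢ`, so only the exponents `u` and `w` survive.
  have h0 : ∀ j, ((List.ofFn e).map fun a => e j - a).prod = 0 := by
    intro j
    rw [List.prod_eq_zero_iff]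
    simp only [List.mem_map, List.mem_ofFn]
    exact ⟨e j, ⟨j, rfl⟩, sub_self _⟩
  have hp : ∀ v, ((List.ofFn e).map fun a => v - a).prod = ∏ i, (v - e i) := by
    intro v
    rw [List.map_ofFn, List.prod_ofFn]
    rfl
  have e₁ : expSum (Sum.elim c ![d * α, d * β]) (Sum.elim e ![u, w]) =
      fun x => ∑ i, c i * Real.exp (e i * x) +
        d * (α * Real.exp (u * x) + β * Real.exp (w * x)) := by
    funext x
    simp [expSum, Fintype.sum_sum_type, Fin.sum_univ_two]
    ring
  have e₂ : expSum (fun i => Sum.elim c ![d * α, d * β] i *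
      ((List.ofFn e).map fun a => Sum.elim e ![u, w] i - a).prod) (Sum.elim e ![u, w]) =
      fun x => d * (α * (∏ i, (u - e i)) * Real.exp (u * x) +
        β * (∏ i, (w - e i)) * Real.exp (w * x)) := by
    funext x
    simp only [expSum, Fintype.sum_sum_type, Fin.sum_univ_two, Sum.elim_inl, Sum.elim_inr, h0]
    simp only [hp, mul_zero, zero_mul, Finset.sum_const_zero, zero_add, Matrix.cons_val_zero,
      Matrix.cons_val_one]
    ring
  rwa [List.length_ofFn, e₁, e₂] at h

lemma zerosLE_one_of_exp {α β u w : ℝ} (huw : u ≠ w) (h : α ≠ 0 ∨ β ≠ 0) :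
    ZerosLE (fun x => α * Real.exp (u * x) + β * Real.exp (w * x)) 1 := by
  have := zerosLE_expSum (ι := Fin 2) (n := 1) (by simp) (c := ![α, β]) (e := ![u, w])
    (by
      intro i j hij
      fin_cases i <;> fin_cases j <;> simp_all)
    (by
      intro h0
      have h1 := congrFun h0 0
      have h2 := congrFun h0 1
      simp at h1 h2
      tauto)
  have e : expSum ![α, β] ![u, w] =
      fun x => α * Real.exp (u * x) + β * Real.exp (w * x) := by
    funext x
    simp [expSum, Fin.sum_univ_two]
  rwa [e] at this

lemma exists_exp_add_exp_eq_zero {a b u w : ℝ} (huw : u ≠ w) (hab : a * b < 0) :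
    ∃ x, a * Real.exp (u * x) + b * Real.exp (w * x) = 0 := by
  have hb : b ≠ 0 := by rintro rfl; simp at hab
  have hpos : 0 < -a / b := by
    have : -a / b = -(a * b) / b ^ 2 := by field_simp
    rw [this]
    have : 0 < -(a * b) := by linarith
    positivity
  -- This solves `exp ((w - u) x) = -a / b`.
  refine ⟨Real.log (-a / b) / (w - u), ?_⟩
  have hwu : w - u ≠ 0 := sub_ne_zero.2 huw.symm
  set x := Real.log (-a / b) / (w - u) with hx
  have : Real.exp (w * x) = Real.exp (u * x) * (-a / b) := by
    rw [← Real.exp_log hpos, ← Real.exp_add, hx]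
    congr 1
    field_simp
    ring
  rw [this]
  field_simp
  ring

lemma zerosLE_expSum_add {n N : ℕ} {e c : Fin n → ℝ} {d α β u w : ℝ} (he : Function.Injective e)
    (h : ZerosLE (fun x => α * (∏ i, (u - e i)) * Real.exp (u * x) +
        β * (∏ i, (w - e i)) * Real.exp (w * x)) N) (hcd : c ≠ 0 ∨ d ≠ 0) :
    ZerosLE (fun x => ∑ i, c i * Real.exp (e i * x) +
        d * (α * Real.exp (u * x) + β * Real.exp (w * x))) (N + n) := by
  by_cases hd : d = 0
  · have hc : c ≠ 0 := by tauto
    have := zerosLE_expSum (n := N + n) (by simp; omega) he hc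
    simp only [hd, zero_mul, add_zero]
    exact this
  · exact (Reduces.expSum_add e c d α β u w).zerosLE N
      ((Reduces.mul (by fun_prop) (u := fun _ => d) (fun x => by fun_prop) (fun _ => hd)
        fun x => rfl).zerosLE N h)

/-! ### From the half-line to the real line -/

lemma zeroMultiplicity_eq {f : ℝ → ℝ} {x : ℝ} (hf : AnalyticAt ℝ f x) :
    zeroMultiplicity f x = analyticOrderAt f x := by
  unfold zeroMultiplicity
  refine le_antisymm ?_ ?_
  · rcases eq_or_ne (analyticOrderAt f x) ⊤ with h | h
    · simp [h]
    · obtain ⟨n, hn⟩ := ENat.ne_top_iff_exists.1 h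
      rw [← hn]
      exact iInf₂_le n ((analyticOrderAt_eq_nat_iff_iteratedDeriv_eq_zero hf).1 hn.symm).2
  · refine le_iInf₂ fun i hi => ?_
    by_contra! hlt
    have : ((i + 1 : ℕ) : ℕ∞) ≤ analyticOrderAt f x := by
      push_cast
      exact Order.add_one_le_of_lt hlt
    exact hi ((natCast_le_analyticOrderAt_iff_iteratedDeriv_eq_zero hf).1 this i (by omega))

lemma analyticOrderAt_comp_exp (f : ℝ → ℝ) (x : ℝ) :
    analyticOrderAt (fun t => f (Real.exp t)) x = analyticOrderAt f (Real.exp x) :=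
  analyticOrderAt_comp_of_deriv_ne_zero (f := f) (g := Real.exp) analyticAt_rexp
    (by simp)

lemma analyticAt_of_comp_exp {f : ℝ → ℝ} (hf : ∀ t, AnalyticAt ℝ (fun t => f (Real.exp t)) t)
    {x : ℝ} (hx : 0 < x) : AnalyticAt ℝ f x := by
  have h := (hf (Real.log x)).comp (analyticAt_log hx)
  refine h.congr ?_
  filter_upwards [lt_mem_nhds hx] with y hy
  simp [Real.exp_log hy]

lemma zeroCount_le {f : ℝ → ℝ} (hf : ∀ t, AnalyticAt ℝ (fun t => f (Real.exp t)) t) {N : ℕ}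
    (h : ZerosLE (fun t => f (Real.exp t)) N) : zeroCount f ≤ N := by
  classical
  refine iSup₂_le fun S hS => ?_
  refine le_trans (le_of_eq ?_) (h (S.image Real.log))
  rw [Finset.sum_image]
  · refine Finset.sum_congr rfl fun x hx => ?_
    have hx0 := (hS x hx).1
    rw [zeroMultiplicity_eq (analyticAt_of_comp_exp hf hx0), analyticOrderAt_comp_exp,
      Real.exp_log hx0]
  · intro x hx y hy hxy
    exact Real.log_injOn_pos (hS x hx).1 (hS y hy).1 hxy

/-- This covers the zero combination, which lies in every span: none of its zeros is isolated. -/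
lemma zeroCount_eq_zero {f : ℝ → ℝ} (hf : ∀ t, f (Real.exp t) = 0) : zeroCount f = 0 := by
  refine le_antisymm (iSup₂_le fun S hS => ?_) bot_le
  suffices S = ∅ by simp [this]
  refine Finset.eq_empty_of_forall_notMem fun x hx => ?_
  obtain ⟨hx0, -, hx2⟩ := hS x hx
  have hev : ∀ᶠ y in 𝓝[≠] x, f y = 0 := by
    refine Filter.Eventually.filter_mono nhdsWithin_le_nhds ?_
    filter_upwards [lt_mem_nhds hx0] with y hy
    rw [← Real.exp_log hy, hf]
  obtain ⟨y, hy1, hy2⟩ := (hx2.and hev).exists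
  exact hy1 hy2

/-- The bound `M` only serves to make the order finite, so that the zero is isolated and is counted.
-/
lemma le_zeroCount {f : ℝ → ℝ} (hf : ∀ t, AnalyticAt ℝ (fun t => f (Real.exp t)) t) {N M : ℕ}
    (hM : ZerosLE (fun t => f (Real.exp t)) M) {t : ℝ}
    (h : (N : ℕ∞) ≤ analyticOrderAt (fun t => f (Real.exp t)) t) : (N : ℕ∞) ≤ zeroCount f := by
  rcases Nat.eq_zero_or_pos N with rfl | hN
  · simp
  rw [analyticOrderAt_comp_exp] at h
  have hpos := Real.exp_pos t
  have hfa := analyticAt_of_comp_exp hf hpos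
  have h0 : f (Real.exp t) = 0 := apply_eq_zero_of_analyticOrderAt_ne_zero (by
    intro h0
    rw [h0] at h
    have : N ≤ 0 := by exact_mod_cast h
    omega)
  have hfin : analyticOrderAt f (Real.exp t) ≠ ⊤ := by
    have := hM {t}
    rw [Finset.sum_singleton, analyticOrderAt_comp_exp] at this
    exact ne_top_of_le_ne_top (ENat.natCast_ne_top M) this
  have hiso : IsIsolatedZero f (Real.exp t) := by
    refine ⟨hpos, h0, ?_⟩
    rcases hfa.eventually_eq_zero_or_eventually_ne_zero with h1 | h1
    · exact absurd (analyticOrderAt_eq_top.2 h1) hfin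
    · exact h1
  refine le_iSup₂_of_le {Real.exp t} (by simpa using hiso) ?_
  rw [Finset.sum_singleton, zeroMultiplicity_eq hfa]
  exact h

/-! ### Exact zero counts for the span of a family -/

section Family

variable {n : ℕ} {F U : Fin n → ℝ → ℝ}

lemma maxZerosEq_of_bounds (hFU : ∀ j t, F j (Real.exp t) = U j t)
    (hU : ∀ j t, AnalyticAt ℝ (U j) t) {N : ℕ}
    (upper : ∀ c : Fin n → ℝ, c ≠ 0 → ZerosLE (fun t => ∑ j, c j * U j t) N)
    (lower : ∃ c : Fin n → ℝ, c ≠ 0 ∧ ∃ t, (N : ℕ∞) ≤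
      analyticOrderAt (fun t => ∑ j, c j * U j t) t) : MaxZerosEq F N := by
  have hcomp : ∀ c : Fin n → ℝ, (fun t => (∑ j, c j • F j) (Real.exp t)) =
      fun t => ∑ j, c j * U j t := by
    intro c
    funext t
    simp [hFU]
  have hana : ∀ c : Fin n → ℝ, ∀ t,
      AnalyticAt ℝ (fun t => (∑ j, c j • F j) (Real.exp t)) t := by
    intro c t
    rw [hcomp]
    exact Finset.univ.analyticAt_fun_sum fun j _ => analyticAt_const.mul (hU j t)
  have hupper : ∀ c : Fin n → ℝ, zeroCount (∑ j, c j • F j) ≤ N := by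
    intro c
    rcases eq_or_ne c 0 with rfl | hc
    · rw [zeroCount_eq_zero (by simp)]
      exact bot_le
    · exact zeroCount_le (hana c) (by rw [hcomp]; exact upper c hc)
  refine ⟨?_, ?_⟩
  · obtain ⟨c, hc, t, ht⟩ := lower
    refine ⟨∑ j, c j • F j, (Submodule.mem_span_range_iff_exists_fun ℝ).2 ⟨c, rfl⟩,
      le_antisymm (hupper c) ?_⟩
    refine le_zeroCount (hana c) (M := N) ?_ (t := t) ?_
    · rw [hcomp]; exact upper c hc
    · rw [hcomp]; exact ht
  · rintro _ ⟨f, hf, rfl⟩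
    obtain ⟨c, rfl⟩ := (Submodule.mem_span_range_iff_exists_fun ℝ).1 hf
    exact hupper c

end Family

section FamilySucc

variable {n : ℕ} {F U : Fin (n + 1) → ℝ → ℝ}

/-- The derivatives of orders `0, …, n - 1` at `t` give `n` linear equations in `n + 1`
coefficients. -/
lemma exists_le_analyticOrderAt (hU : ∀ j t, AnalyticAt ℝ (U j) t) (t : ℝ) :
    ∃ c : Fin (n + 1) → ℝ, c ≠ 0 ∧
      (n : ℕ∞) ≤ analyticOrderAt (fun t => ∑ j, c j * U j t) t := by
  let A : (Fin (n + 1) → ℝ) →ₗ[ℝ] (Fin n → ℝ) :=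
    Matrix.mulVecLin (Matrix.of fun (i : Fin n) j => iteratedDeriv i (U j) t)
  obtain ⟨c, hc, hc0⟩ := (Submodule.ne_bot_iff _).1 (A.ker_ne_bot_of_finrank_lt (by simp))
  refine ⟨c, hc0, (natCast_le_analyticOrderAt_iff_iteratedDeriv_eq_zero ?_).2 fun i hi => ?_⟩
  · exact Finset.univ.analyticAt_fun_sum fun j _ => analyticAt_const.mul (hU j t)
  · have := congrFun (LinearMap.mem_ker.1 hc) ⟨i, hi⟩
    rw [iteratedDeriv_fun_sum (f := fun j t => c j * U j t) fun j _ => (analyticAt_const.mul (hU j t)).contDiffAt]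
    simp only [iteratedDeriv_const_mul_field]
    simpa [A, Matrix.mulVec, dotProduct, mul_comm] using this

lemma maxZerosEq_of_upper (hFU : ∀ j t, F j (Real.exp t) = U j t)
    (hU : ∀ j t, AnalyticAt ℝ (U j) t)
    (upper : ∀ c : Fin (n + 1) → ℝ, c ≠ 0 → ZerosLE (fun t => ∑ j, c j * U j t) n) :
    MaxZerosEq F n := by
  refine maxZerosEq_of_bounds hFU hU upper ?_
  obtain ⟨c, hc, h⟩ := exists_le_analyticOrderAt hU 0
  exact ⟨c, hc, 0, h⟩

/-- One zero more than the dimension count gives: a combination of order at least `n` at `t` has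
order exactly `n` plus that of `H c`, and every `H c` vanishes at the same `t`. -/
lemma maxZerosEq_of_reduces (hFU : ∀ j t, F j (Real.exp t) = U j t)
    (hU : ∀ j t, AnalyticAt ℝ (U j) t)
    (upper : ∀ c : Fin (n + 1) → ℝ, c ≠ 0 → ZerosLE (fun t => ∑ j, c j * U j t) (n + 1))
    {H : (Fin (n + 1) → ℝ) → ℝ → ℝ} {t : ℝ}
    (hred : ∀ c, Reduces n (fun t => ∑ j, c j * U j t) (H c))
    (hH : ∀ c, AnalyticAt ℝ (H c) t) (hHt : ∀ c, H c t = 0) : MaxZerosEq F (n + 1) := by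
  refine maxZerosEq_of_bounds hFU hU upper ?_
  obtain ⟨c, hc, h⟩ := exists_le_analyticOrderAt hU t
  refine ⟨c, hc, t, ?_⟩
  rw [← (hred c).order t h, Nat.cast_add, Nat.cast_one, add_comm]
  gcongr
  rw [Order.one_le_iff_ne_zero, (hH c).analyticOrderAt_ne_zero]
  exact hHt c

/-- Pure powers with distinct exponents. -/
lemma maxZerosEq_of_exp {e : Fin (n + 1) → ℝ} (he : Function.Injective e)
    (hF : ∀ j t, F j (Real.exp t) = Real.exp (e j * t)) : MaxZerosEq F n :=
  maxZerosEq_of_upper (U := fun j t => Real.exp (e j * t)) hF (fun j t => by fun_prop)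
    fun _ hc => zerosLE_expSum (by simp) he hc

variable {e : Fin n → ℝ} {α β u w : ℝ}

lemma snoc_ne_zero {c : Fin (n + 1) → ℝ} (hc : c ≠ 0) :
    (fun i : Fin n => c i.castSucc) ≠ 0 ∨ c (Fin.last n) ≠ 0 := by
  by_contra! h
  refine hc (funext fun i => ?_)
  refine Fin.lastCases h.2 (fun j => congrFun h.1 j) i

/-- Pure powers with distinct exponents and one binomial. -/
lemma maxZerosEq_of_exp_add (he : Function.Injective e)
    (hF : ∀ j : Fin n, ∀ t, F j.castSucc (Real.exp t) = Real.exp (e j * t))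
    (hFl : ∀ t, F (Fin.last n) (Real.exp t) = α * Real.exp (u * t) + β * Real.exp (w * t))
    (h : ∀ x, α * (∏ i, (u - e i)) * Real.exp (u * x) +
        β * (∏ i, (w - e i)) * Real.exp (w * x) ≠ 0) : MaxZerosEq F n := by
  have hU : ∀ j t, AnalyticAt ℝ (fun t => F j (Real.exp t)) t := by
    intro j t
    refine Fin.lastCases ?_ (fun j => ?_) j
    · simp only [hFl]; fun_prop
    · simp only [hF]; fun_prop
  refine maxZerosEq_of_upper (fun _ _ => rfl) hU fun c hc => ?_
  simp only [Fin.sum_univ_castSucc, hF, hFl]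
  simpa using zerosLE_expSum_add he (zerosLE_zero_of_ne_zero h) (snoc_ne_zero hc)

/-- All reductions are multiples of one sum of two exponentials. Opposite signs of its coefficients
give it a zero, common to all reductions. -/
lemma maxZerosEq_succ_of_exp_add (he : Function.Injective e)
    (hF : ∀ j : Fin n, ∀ t, F j.castSucc (Real.exp t) = Real.exp (e j * t))
    (hFl : ∀ t, F (Fin.last n) (Real.exp t) = α * Real.exp (u * t) + β * Real.exp (w * t))
    (huw : u ≠ w)
    (h : α * (∏ i, (u - e i)) * (β * (∏ i, (w - e i))) < 0) : MaxZerosEq F (n + 1) := by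
  have hU : ∀ j t, AnalyticAt ℝ (fun t => F j (Real.exp t)) t := by
    intro j t
    refine Fin.lastCases ?_ (fun j => ?_) j
    · simp only [hFl]; fun_prop
    · simp only [hF]; fun_prop
  obtain ⟨t, ht⟩ := exists_exp_add_exp_eq_zero huw h
  have hne : α * (∏ i, (u - e i)) ≠ 0 := left_ne_zero_of_mul h.ne
  refine maxZerosEq_of_reduces (fun _ _ => rfl) hU (fun c hc => ?_) (t := t) (fun c => ?_)
    (H := fun c x => c (Fin.last n) * (α * (∏ i, (u - e i)) * Real.exp (u * x) +
        β * (∏ i, (w - e i)) * Real.exp (w * x))) (fun c => by fun_prop) (fun c => by simp [ht])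
  · simp only [Fin.sum_univ_castSucc, hF, hFl]
    rw [add_comm n 1]
    exact zerosLE_expSum_add he (zerosLE_one_of_exp huw (Or.inl hne)) (snoc_ne_zero hc)
  · simp only [Fin.sum_univ_castSucc, hF, hFl]
    exact Reduces.expSum_add e _ _ α β u w

end FamilySucc

/-! ### Polynomials in an exponential -/

section Poly

open Polynomial

/-- Up to sign the coefficients are the elementary symmetric functions of positive numbers. The weak
inequality for every `i` is carried along because in the induction the top coefficient receives a
zero summand from beyond the degree. -/
lemma coeff_prod_X_sub_C_alternating (R : Multiset ℝ) (hR : ∀ r ∈ R, 0 < r) :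
    (∀ i, 0 ≤ (-1) ^ (R.card + i) * (R.map fun r => X - C r).prod.coeff i) ∧
      ∀ i ≤ R.card, 0 < (-1) ^ (R.card + i) * (R.map fun r => X - C r).prod.coeff i := by
  induction R using Multiset.induction_on with
  | empty =>
    refine ⟨fun i => ?_, fun i hi => ?_⟩
    · rcases i with _ | i <;> simp [coeff_one]
    · obtain rfl : i = 0 := by simpa using hi
      simp
  | cons r R ih =>
    obtain ⟨h₁, h₂⟩ := ih fun s hs => hR s (Multiset.mem_cons_of_mem hs)
    have hr := hR r (Multiset.mem_cons_self r R)
    have e0 : (-1 : ℝ) ^ ((r ::ₘ R).card + 0) *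
        (((r ::ₘ R).map fun r => X - C r).prod.coeff 0) =
        r * ((-1) ^ (R.card + 0) * (R.map fun r => X - C r).prod.coeff 0) := by
      rw [Multiset.map_cons, Multiset.prod_cons, mul_coeff_zero, Multiset.card_cons]
      simp
      ring
    have e1 : ∀ i, (-1 : ℝ) ^ ((r ::ₘ R).card + (i + 1)) *
        (((r ::ₘ R).map fun r => X - C r).prod.coeff (i + 1)) =
        (-1) ^ (R.card + i) * (R.map fun r => X - C r).prod.coeff i +
        r * ((-1) ^ (R.card + (i + 1)) * (R.map fun r => X - C r).prod.coeff (i + 1)) := by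
      intro i
      rw [Multiset.map_cons, Multiset.prod_cons, sub_mul, coeff_sub, coeff_X_mul, coeff_C_mul,
        Multiset.card_cons]
      ring
    refine ⟨fun i => ?_, fun i hi => ?_⟩
    · rcases i with _ | i
      · rw [e0]; exact mul_nonneg hr.le (h₁ 0)
      · rw [e1]; exact add_nonneg (h₁ i) (mul_nonneg hr.le (h₁ _))
    · rcases i with _ | i
      · rw [e0]; exact mul_pos hr (h₂ 0 (Nat.zero_le _))
      · rw [Multiset.card_cons] at hi
        rw [e1]; exact add_pos_of_pos_of_nonneg (h₂ i (by omega)) (mul_nonneg hr.le (h₁ _))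

lemma analyticOrderAt_eval_exp {p : ℝ[X]} (hp : p ≠ 0) {a : ℝ} (ha : a ≠ 0) (x : ℝ) :
    analyticOrderAt (fun x => p.eval (Real.exp (a * x))) x =
      p.rootMultiplicity (Real.exp (a * x)) := by
  have hg : AnalyticAt ℝ (fun x => Real.exp (a * x)) x := by fun_prop
  have hd : deriv (fun x => Real.exp (a * x)) x ≠ 0 := by
    have := ((hasDerivAt_id x).const_mul a).exp
    simp only [id] at this
    rw [this.deriv]
    simp [ha]
  have h := analyticOrderAt_comp_of_deriv_ne_zero (f := fun y => p.eval y) hg hd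
  rw [show (fun x => p.eval (Real.exp (a * x))) =
    (fun y => p.eval y) ∘ fun x => Real.exp (a * x) from rfl, h]
  set r := Real.exp (a * x)
  have han : ∀ q : ℝ[X], AnalyticAt ℝ (fun y => q.eval y) r := by
    intro q
    simpa using AnalyticAt.aeval_polynomial (𝕜 := ℝ) (z := r) (f := id) analyticAt_id q
  rw [(han p).analyticOrderAt_eq_natCast]
  obtain ⟨q, hq, hq'⟩ := p.exists_eq_pow_rootMultiplicity_mul_and_not_dvd hp r
  refine ⟨fun y => q.eval y, han q, ?_, Filter.Eventually.of_forall fun y => ?_⟩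
  · rwa [dvd_iff_isRoot] at hq'
  · conv_lhs => rw [hq]
    simp

/-- With `n + 1` positive roots, `p` would have degree `n + 1` and split, so its coefficients would
alternate strictly in sign. Paired with the alternating `l`, all terms would then have the same
strict sign, and the sum could not vanish. -/
lemma zerosLE_eval_exp {n : ℕ} {p : ℝ[X]} (hp : p ≠ 0) (hdeg : p.natDegree ≤ n + 1)
    {l : ℕ → ℝ} (hl : ∀ i ≤ n + 1, 0 < (-1) ^ i * l i)
    (hlp : ∑ i ∈ Finset.range (n + 2), l i * p.coeff i = 0) {a : ℝ} (ha : a ≠ 0) :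
    ZerosLE (fun x => p.eval (Real.exp (a * x))) n := by
  classical
  set R := p.roots.filter (0 < ·) with hR
  have hRle : R ≤ p.roots := Multiset.filter_le _ _
  have hcard : R.card ≤ n := by
    by_contra! hlt
    have hle : R.card ≤ p.natDegree := (Multiset.card_le_card hRle).trans p.card_roots'
    have hpc : p.natDegree = n + 1 := by omega
    have hRc : R.card = n + 1 := by omega
    have hRe : R = p.roots := Multiset.eq_of_le_of_card_le hRle (by
      have := p.card_roots'
      omega)
    have hsplit : C p.leadingCoeff * (R.map fun r => X - C r).prod = p := by
      rw [hRe]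
      exact C_leadingCoeff_mul_prod_multiset_X_sub_C (by rw [← hRe]; omega)
    obtain ⟨-, halt⟩ := coeff_prod_X_sub_C_alternating R
      (fun r hr => (Multiset.mem_filter.1 hr).2)
    have hpos : 0 < ∑ i ∈ Finset.range (n + 2),
        ((-1) ^ i * l i) * ((-1) ^ (R.card + i) * (R.map fun r => X - C r).prod.coeff i) := by
      refine Finset.sum_pos (fun i hi => ?_) (by simp)
      rw [Finset.mem_range] at hi
      exact mul_pos (hl i (by omega)) (halt i (by omega))
    have heq : ∑ i ∈ Finset.range (n + 2), l i * p.coeff i =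
        p.leadingCoeff * (-1) ^ R.card * ∑ i ∈ Finset.range (n + 2),
        ((-1) ^ i * l i) * ((-1) ^ (R.card + i) * (R.map fun r => X - C r).prod.coeff i) := by
      rw [Finset.mul_sum]
      refine Finset.sum_congr rfl fun i _ => ?_
      conv_lhs => rw [← hsplit, coeff_C_mul]
      have h1 : ((-1 : ℝ) ^ R.card) * (-1) ^ R.card = 1 := by
        rw [← mul_pow]; simp
      have h2 : ((-1 : ℝ) ^ i) * (-1) ^ i = 1 := by
        rw [← mul_pow]; simp
      rw [pow_add]
      linear_combination (-(p.leadingCoeff * l i * (R.map fun r => X - C r).prod.coeff i)) *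
        ((-1 : ℝ) ^ i * (-1) ^ i * h1 + h2)
    rw [heq] at hlp
    exact mul_ne_zero (mul_ne_zero (leadingCoeff_ne_zero.2 hp) (by simp)) hpos.ne' hlp
  intro S
  calc ∑ x ∈ S, analyticOrderAt (fun x => p.eval (Real.exp (a * x))) x
      = ∑ x ∈ S, ((R.count (Real.exp (a * x)) : ℕ) : ℕ∞) := by
        refine Finset.sum_congr rfl fun x _ => ?_
        rw [analyticOrderAt_eval_exp hp ha, hR, Multiset.count_filter_of_pos (Real.exp_pos _),
          count_roots]
    _ = ((∑ y ∈ S.image (fun x => Real.exp (a * x)), R.count y : ℕ) : ℕ∞) := by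
        rw [Finset.sum_image]
        · push_cast; rfl
        · intro x _ y _ hxy
          exact mul_left_cancel₀ ha (Real.exp_injective hxy)
    _ ≤ (n : ℕ∞) := by
        -- Enlarging the index set by the support of `R` turns the sum of counts into the
        -- cardinality.
        have : ∑ y ∈ S.image (fun x => Real.exp (a * x)), R.count y ≤ R.card :=
          (Finset.sum_le_sum_of_subset Finset.subset_union_left).trans
            (Multiset.sum_count_eq_card (s := _ ∪ R.toFinset) fun r hr =>
              Finset.mem_union_right _ (Multiset.mem_toFinset.2 hr)).le
        exact_mod_cast this.trans hcard

/-- A polynomial of degree at most `n + 1` whose coefficients are annihilated by an alternating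
functional does not have `n + 1` positive roots. -/
lemma zerosLE_sum_exp_pow {n : ℕ} {v l : Fin (n + 2) → ℝ} (hv : v ≠ 0)
    (hl : ∀ i : Fin (n + 2), 0 < (-1) ^ (i : ℕ) * l i) (hlv : ∑ i, l i * v i = 0) {a : ℝ} (ha : a ≠ 0) :
    ZerosLE (fun x => ∑ i, v i * Real.exp (a * x) ^ (i : ℕ)) n := by
  set p : ℝ[X] := ∑ i, C (v i) * X ^ (i : ℕ) with hp
  have hcoeff : ∀ i : Fin (n + 2), p.coeff i = v i := by
    intro i
    simp [hp, coeff_X_pow, Fin.val_inj]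
  have hp0 : p ≠ 0 := by
    intro h
    refine hv (funext fun i => ?_)
    rw [← hcoeff i, h]
    simp
  have hdeg : p.natDegree ≤ n + 1 :=
    natDegree_sum_le_of_forall_le _ _ fun i _ => (natDegree_C_mul_X_pow_le _ _).trans (by omega)
  have := zerosLE_eval_exp (l := fun i => if h : i < n + 2 then l ⟨i, h⟩ else 0) hp0 hdeg
    (fun i hi => by simpa [show i < n + 2 by omega] using hl ⟨i, by omega⟩) (by
      rw [Finset.sum_range, ← hlv]
      refine Finset.sum_congr rfl fun i _ => ?_
      simp [hcoeff i]) ha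
  simpa [hp, eval_finsetSum] using this

end Poly

/-! ### The families in the variable `log x` -/

lemma exp_rpow (t k : ℝ) : Real.exp t ^ k = Real.exp (k * t) := by
  rw [mul_comm, Real.exp_mul]

lemma maxZerosEq_G0 (k : ℝ) : MaxZerosEq (G0 k) 0 :=
  maxZerosEq_of_exp (e := ![k]) (fun i j _ => Subsingleton.elim (α := Fin 1) i j) fun j t => by
    fin_cases j
    simp [G0, u1, exp_rpow]

lemma maxZerosEq_G1 {k : ℝ} (hk : 0 < k) : MaxZerosEq (G1 k) 1 :=
  maxZerosEq_of_exp (e := ![0, k])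
    (by intro i j h; fin_cases i <;> fin_cases j <;> simp_all)
    fun j t => by fin_cases j <;> simp [G1, u0, u1, exp_rpow]

lemma maxZerosEq_G10 {k : ℝ} (hk : 0 < k) : MaxZerosEq (G10 k) 2 :=
  maxZerosEq_of_exp (e := ![0, k, 2 * k])
    (by
      intro i j h
      fin_cases i <;> fin_cases j <;> simp at h ⊢ <;> linarith)
    fun j t => by fin_cases j <;> simp [G10, u0, u1, u13, exp_rpow]

lemma maxZerosEq_G11 : MaxZerosEq (G11 1) 1 :=
  maxZerosEq_of_exp (e := ![1, 1 - 2])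
    (by
      intro i j h
      fin_cases i <;> fin_cases j <;> simp at h ⊢ <;> linarith)
    fun j t => by fin_cases j <;> simp [G11, u1, u3, exp_rpow]

/-! ### The family `G3` -/

lemma injective_G3 {k : ℝ} (hk : 1 < k) : Function.Injective ![0, k - 1] := by
  intro i j h
  fin_cases i <;> fin_cases j <;> simp at h ⊢ <;> linarith

lemma G3_castSucc (k : ℝ) (j : Fin 2) (t : ℝ) :
    G3 k j.castSucc (Real.exp t) = Real.exp (![0, k - 1] j * t) := by
  fin_cases j <;> simp [G3, u0, u2, exp_rpow]

lemma G3_last (k t : ℝ) : G3 k (Fin.last 2) (Real.exp t) =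
    1 * Real.exp (1 * t) + 1 * Real.exp ((2 * k - 1) * t) := by
  simp [G3, u8, exp_rpow, Fin.last]

/-- The two remaining coefficients are `2 - k` and `(2k - 1) k`. The second is positive, so the sign
of the first decides between two and three zeros; at `k = 2` it merely drops out. -/
lemma maxZerosEq_G3_two {k : ℝ} (hk : k ∈ Set.Ioc (1 : ℝ) 2) : MaxZerosEq (G3 k) 2 := by
  obtain ⟨h1, h2⟩ := hk
  refine maxZerosEq_of_exp_add (injective_G3 h1) (G3_castSucc k) (G3_last k) fun x => ?_
  simp only [Fin.prod_univ_two, Matrix.cons_val_zero, Matrix.cons_val_one]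
  refine (add_pos_of_nonneg_of_pos ?_ ?_).ne'
  · exact mul_nonneg (by linarith) (Real.exp_pos _).le
  · refine mul_pos ?_ (Real.exp_pos _)
    have : (0 : ℝ) < (2 * k - 1) * k := mul_pos (by linarith) (by linarith)
    linarith

lemma maxZerosEq_G3_three {k : ℝ} (hk : 2 < k) : MaxZerosEq (G3 k) 3 := by
  refine maxZerosEq_succ_of_exp_add (injective_G3 (by linarith)) (G3_castSucc k) (G3_last k)
    (by intro h; linarith) ?_
  simp only [Fin.prod_univ_two, Matrix.cons_val_zero, Matrix.cons_val_one]
  have : (0 : ℝ) < (2 * k - 1) * k := mul_pos (by linarith) (by linarith)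
  exact mul_neg_of_neg_of_pos (by linarith) (by linarith)

/-! ### The family `G5` -/

/-- The exponents of the pure powers in `G5`. -/
def expG5 (k : ℝ) : Fin 7 → ℝ :=
  ![k - 1, 2 * k - 2, 2 * k - 1, 0, k, 3 * k - 2, 3 * k - 3]

/-- At `k = 2` one has `2k - 2 = k`, and at `k = 3/2` one has `3k - 3 = k`; for other `k > 1` no
exponents collide. -/
lemma injective_expG5 {k : ℝ} (h1 : 1 < k) (h2 : k ≠ 2) (h3 : k ≠ 3 / 2) :
    Function.Injective (expG5 k) := by
  intro i j h
  fin_cases i <;> fin_cases j <;> first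
    | rfl
    | (exfalso
       simp [expG5] at h <;> first
        | linarith
        | exact h2 (by linarith)
        | exact h3 (by linarith))

lemma G5_castSucc (k : ℝ) (j : Fin 7) (t : ℝ) :
    G5 k j.castSucc (Real.exp t) = Real.exp (expG5 k j * t) := by
  fin_cases j <;> simp [G5, expG5, u0, u1, u2, u4, u5, u6, u7, exp_rpow]

lemma G5_last (k t : ℝ) : G5 k (Fin.last 7) (Real.exp t) =
    1 * Real.exp (1 * t) + k * Real.exp ((4 * k - 3) * t) := by
  simp [G5, u9, exp_rpow, Fin.last]

/-- The cubic factor carries the sign for `k > 1`; its roots `4/3`, `3/2`, `2` are the ends of the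
ranges of `k`. -/
lemma prod_one_sub_expG5 (k : ℝ) :
    ∏ i, (1 - expG5 k i) = 6 * (k - 1) ^ 3 * (-((2 - k) * (3 - 2 * k) * (4 - 3 * k))) := by
  simp [expG5, Fin.prod_univ_succ]
  ring

lemma prod_sub_expG5_pos {k : ℝ} (hk : 1 < k) : 0 < ∏ i, (4 * k - 3 - expG5 k i) := by
  refine Finset.prod_pos fun i _ => ?_
  fin_cases i <;> simp [expG5] <;> linarith

lemma maxZerosEq_G5_seven {k : ℝ} (hk : k ∈ Set.Ico (4 / 3 : ℝ) (3 / 2) ∪ Set.Ioi 2) :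
    MaxZerosEq (G5 k) 7 := by
  have h1 : 1 < k := by rcases hk with ⟨h, -⟩ | h <;> [skip; rw [Set.mem_Ioi] at h] <;> linarith
  have h2 : k ≠ 2 := by
    rintro rfl
    norm_num at hk
  have h3 : k ≠ 3 / 2 := by
    rintro rfl
    norm_num at hk
  have hsign : 0 ≤ -((2 - k) * (3 - 2 * k) * (4 - 3 * k)) := by
    rcases hk with ⟨ha, hb⟩ | h
    · have := mul_nonneg (mul_nonneg (by linarith : 0 ≤ 2 - k) (by linarith : 0 ≤ 3 - 2 * k))
        (by linarith : 0 ≤ 3 * k - 4)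
      linarith
    · rw [Set.mem_Ioi] at h
      have := mul_nonneg (mul_nonneg (by linarith : 0 ≤ k - 2) (by linarith : 0 ≤ 2 * k - 3))
        (by linarith : 0 ≤ 3 * k - 4)
      linarith
  refine maxZerosEq_of_exp_add (injective_expG5 h1 h2 h3) (G5_castSucc k) (G5_last k) fun x => ?_
  have hp := prod_sub_expG5_pos h1
  have h0 : 0 < k - 1 := by linarith
  rw [prod_one_sub_expG5]
  refine (add_pos_of_nonneg_of_pos ?_ ?_).ne'
  · positivity
  · positivity

lemma maxZerosEq_G5_eight {k : ℝ} (hk : k ∈ Set.Ioo (1 : ℝ) (4 / 3) ∪ Set.Ioo (3 / 2) 2) :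
    MaxZerosEq (G5 k) 8 := by
  have h1 : 1 < k := by rcases hk with ⟨h, -⟩ | ⟨h, -⟩ <;> linarith
  have h2 : k ≠ 2 := by
    rintro rfl
    norm_num at hk
  have h3 : k ≠ 3 / 2 := by
    rintro rfl
    norm_num at hk
  have hsign : -((2 - k) * (3 - 2 * k) * (4 - 3 * k)) < 0 := by
    rcases hk with ⟨ha, hb⟩ | ⟨ha, hb⟩
    · have := mul_pos (mul_pos (by linarith : 0 < 2 - k) (by linarith : 0 < 3 - 2 * k))
        (by linarith : 0 < 4 - 3 * k)
      linarith
    · have := mul_pos (mul_pos (by linarith : 0 < 2 - k) (by linarith : 0 < 2 * k - 3))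
        (by linarith : 0 < 3 * k - 4)
      linarith
  have h0 : 0 < k - 1 := by linarith
  refine maxZerosEq_succ_of_exp_add (injective_expG5 h1 h2 h3) (G5_castSucc k) (G5_last k)
    (by intro h; linarith) ?_
  rw [prod_one_sub_expG5, one_mul]
  refine mul_neg_of_neg_of_pos (mul_neg_of_pos_of_neg (by positivity) hsign)
    (mul_pos (by linarith) (prod_sub_expG5_pos h1))

/-! ### The families `G2` and `G4` -/

lemma analyticAt_arctan (x : ℝ) : AnalyticAt ℝ Real.arctan x :=
  (Real.contDiff_arctan (n := ⊤)).contDiffAt.analyticAt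

lemma analyticAt_arctan_exp (a x : ℝ) : AnalyticAt ℝ (fun t => Real.arctan (Real.exp (a * t))) x :=
  (analyticAt_arctan _).fun_comp (by fun_prop)

/-- Dividing by `u8` isolates the arctangent, so one differentiation makes it rational and removes
`b`. Clearing the factor `E / (1 + E²)²` with `E = exp ((k - 1) t)` leaves an exponential sum. -/
lemma reduces_arctan (k a b c d : ℝ) :
    Reduces 1 (fun t => a * ((Real.exp t + Real.exp ((2 * k - 1) * t)) *
          Real.arctan (Real.exp ((k - 1) * t))) +
        b * (Real.exp t + Real.exp ((2 * k - 1) * t)) + c * Real.exp (k * t) +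
        d * Real.exp ((k - 1) * t))
      (fun t => ∑ i, ![(k - 1) * (a + c), (k - 1) * (a - c)] i *
          Real.exp (![0, 2 * k - 2] i * t) +
        d * ((k - 2) * Real.exp (-1 * t) + (-k) * Real.exp ((2 * k - 3) * t))) := by
  have harc := analyticAt_arctan_exp (k - 1)
  have hpos : ∀ t, (0 : ℝ) < 1 + Real.exp ((k - 1) * t) ^ 2 := fun t => by positivity
  have hpos' : ∀ t, 1 + Real.exp ((k - 1) * t) ^ 2 ≠ 0 := fun t => (hpos t).ne'
  have hquot : ∀ x, AnalyticAt ℝ (fun t => (c * Real.exp ((k - 1) * t) +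
      d * Real.exp ((k - 2) * t)) / (1 + Real.exp ((k - 1) * t) ^ 2)) x := fun x =>
    AnalyticAt.div (by fun_prop) (by fun_prop) (hpos' x)
  set g : ℝ → ℝ := fun t => a * Real.arctan (Real.exp ((k - 1) * t)) + b +
    (c * Real.exp ((k - 1) * t) + d * Real.exp ((k - 2) * t)) /
      (1 + Real.exp ((k - 1) * t) ^ 2) with hg
  have hga : ∀ x, AnalyticAt ℝ g x := fun x =>
    ((analyticAt_const.mul (harc x)).add analyticAt_const).add (hquot x)
  refine Reduces.trans (m := 0) (n := 1) (g := g) (Reduces.mul hga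
    (u := fun t => Real.exp t + Real.exp ((2 * k - 1) * t)) (fun x => by fun_prop)
    (fun x => (add_pos (Real.exp_pos _) (Real.exp_pos _)).ne') fun t => ?_)
    (Reduces.of_hasDerivAt hga
      (u := fun t => Real.exp ((k - 1) * t) / (1 + Real.exp ((k - 1) * t) ^ 2) ^ 2)
      (fun x => by simp only [Fin.sum_univ_two]; fun_prop)
      (fun x => AnalyticAt.div (by fun_prop) (by fun_prop) (pow_ne_zero _ (hpos' x)))
      (fun x => div_ne_zero (Real.exp_pos _).ne' (pow_ne_zero _ (hpos' x))) fun t => ?_)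
  · have h0 := hpos' t
    have e1 : Real.exp ((2 * k - 1) * t) = Real.exp t * Real.exp ((k - 1) * t) ^ 2 := by
      rw [← Real.exp_nat_mul, ← Real.exp_add]
      push_cast
      ring_nf
    have e2 : Real.exp (k * t) = Real.exp t * Real.exp ((k - 1) * t) := by
      rw [← Real.exp_add]
      ring_nf
    have e3 : Real.exp ((k - 1) * t) = Real.exp t * Real.exp ((k - 2) * t) := by
      rw [← Real.exp_add]
      ring_nf
    have e4 : d * Real.exp ((k - 1) * t) = d * (Real.exp t * Real.exp ((k - 2) * t)) := by
      rw [← e3]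
    rw [hg, e1, e2, e4]
    field_simp
    ring
  · have h0 := hpos' t
    have hE : HasDerivAt (fun t => Real.exp ((k - 1) * t))
        (Real.exp ((k - 1) * t) * (k - 1)) t := by
      simpa using ((hasDerivAt_id t).const_mul (k - 1)).exp
    have hE' : HasDerivAt (fun t => Real.exp ((k - 2) * t))
        (Real.exp ((k - 2) * t) * (k - 2)) t := by
      simpa using ((hasDerivAt_id t).const_mul (k - 2)).exp
    have hD := ((hE.arctan.const_mul a).add_const b).add
      (((hE.const_mul c).add (hE'.const_mul d)).div ((hE.pow 2).const_add 1) h0)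
    refine hD.congr_deriv ?_
    have e1 : Real.exp ((k - 2) * t) = Real.exp ((k - 1) * t) * Real.exp (-1 * t) := by
      rw [← Real.exp_add]
      ring_nf
    have e2 : Real.exp ((2 * k - 3) * t) = Real.exp ((k - 1) * t) ^ 2 * Real.exp (-1 * t) := by
      rw [← Real.exp_nat_mul, ← Real.exp_add]
      push_cast
      ring_nf
    have e3 : Real.exp ((2 * k - 2) * t) = Real.exp ((k - 1) * t) ^ 2 := by
      rw [← Real.exp_nat_mul]
      push_cast
      ring_nf
    simp only [Fin.sum_univ_two, Matrix.cons_val_zero, Matrix.cons_val_one, zero_mul,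
      Real.exp_zero, Pi.pow_apply, Pi.add_apply, e1, e2, e3]
    field_simp
    push_cast
    ring

lemma G2_sum (k : ℝ) (c : Fin 3 → ℝ) :
    (fun t => ∑ j, c j * G2 k j (Real.exp t)) =
      fun t => c 1 * ((Real.exp t + Real.exp ((2 * k - 1) * t)) *
          Real.arctan (Real.exp ((k - 1) * t))) +
        c 0 * (Real.exp t + Real.exp ((2 * k - 1) * t)) + c 2 * Real.exp (k * t) +
        0 * Real.exp ((k - 1) * t) := by
  funext t
  simp [Fin.sum_univ_three, G2, u8, u11, u1, exp_rpow]
  ring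

lemma G4_sum (k : ℝ) (c : Fin 4 → ℝ) :
    (fun t => ∑ j, c j * G4 k j (Real.exp t)) =
      fun t => c 0 * ((Real.exp t + Real.exp ((2 * k - 1) * t)) *
          Real.arctan (Real.exp ((k - 1) * t))) +
        c 1 * (Real.exp t + Real.exp ((2 * k - 1) * t)) + c 2 * Real.exp (k * t) +
        c 3 * Real.exp ((k - 1) * t) := by
  funext t
  simp [Fin.sum_univ_four, G4, u8, u11, u1, u2, exp_rpow]

lemma analyticAt_u11 (k t : ℝ) : AnalyticAt ℝ (fun t => u11 k (Real.exp t)) t := by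
  simp only [u11, exp_rpow]
  exact AnalyticAt.mul (by fun_prop) (analyticAt_arctan_exp (k - 1) t)

lemma analyticAt_G2 (k : ℝ) (j : Fin 3) (t : ℝ) :
    AnalyticAt ℝ (fun t => G2 k j (Real.exp t)) t := by
  have := analyticAt_u11 k t
  fin_cases j <;> simp [G2, u8, u1, exp_rpow] <;> fun_prop

lemma analyticAt_G4 (k : ℝ) (j : Fin 4) (t : ℝ) :
    AnalyticAt ℝ (fun t => G4 k j (Real.exp t)) t := by
  have := analyticAt_u11 k t
  fin_cases j <;> simp [G4, u8, u1, u2, exp_rpow] <;> fun_prop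

lemma maxZerosEq_G2 {k : ℝ} (hk : k ≠ 1) : MaxZerosEq (G2 k) 2 := by
  have hk0 : k - 1 ≠ 0 := sub_ne_zero.2 hk
  refine maxZerosEq_of_upper (fun _ _ => rfl) (analyticAt_G2 k) fun c hc => ?_
  rw [G2_sum]
  -- Multiples of `u8` have zero derivative after the division and are treated apart; they have no
  -- zeros.
  by_cases h : c 1 = 0 ∧ c 2 = 0
  · have h0 : c 0 ≠ 0 := by
      intro h0
      refine hc (funext fun i => ?_)
      fin_cases i <;> simp [h0, h]
    simp only [h, zero_mul, zero_add, add_zero]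
    exact (zerosLE_zero_of_ne_zero fun x => mul_ne_zero h0
      (add_pos (Real.exp_pos _) (Real.exp_pos _)).ne').mono (by norm_num)
  · refine (reduces_arctan k _ _ _ _).zerosLE 1 ?_
    simp only [Fin.sum_univ_two, Matrix.cons_val_zero, Matrix.cons_val_one, zero_mul (_ + _),
      add_zero]
    refine zerosLE_one_of_exp (by intro h'; apply hk0; linarith) ?_
    by_contra! h'
    have h1 := (mul_eq_zero.1 h'.1).resolve_left hk0
    have h2 := (mul_eq_zero.1 h'.2).resolve_left hk0
    exact h ⟨by linarith, by linarith⟩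

lemma injective_G4 {k : ℝ} (hk : k ≠ 1) : Function.Injective ![0, 2 * k - 2] := by
  intro i j h
  fin_cases i <;> fin_cases j <;> simp at h ⊢ <;> exact hk (by linarith)

lemma zerosLE_G4 {k : ℝ} (hk : k ≠ 1) {N : ℕ}
    (h : ZerosLE (fun x => (k - 2) * (∏ i, (-1 - ![0, 2 * k - 2] i)) * Real.exp (-1 * x) +
        (-k) * (∏ i, (2 * k - 3 - ![0, 2 * k - 2] i)) * Real.exp ((2 * k - 3) * x)) N)
    {c : Fin 4 → ℝ} (hc : c ≠ 0) :
    ZerosLE (fun t => ∑ j, c j * G4 k j (Real.exp t)) (N + 3) := by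
  have hk0 : k - 1 ≠ 0 := sub_ne_zero.2 hk
  rw [G4_sum]
  by_cases h0 : c 0 = 0 ∧ c 2 = 0 ∧ c 3 = 0
  · have h1 : c 1 ≠ 0 := by
      intro h1
      refine hc (funext fun i => ?_)
      fin_cases i <;> simp [h1, h0]
    simp only [h0, zero_mul, zero_add, add_zero]
    exact (zerosLE_zero_of_ne_zero fun x => mul_ne_zero h1
      (add_pos (Real.exp_pos _) (Real.exp_pos _)).ne').mono (Nat.zero_le _)
  · refine (reduces_arctan k _ _ _ _).zerosLE (N + 2)
      (zerosLE_expSum_add (injective_G4 hk) h ?_)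
    by_contra! h'
    have e1 := congrFun h'.1 0
    have e2 := congrFun h'.1 1
    simp only [Matrix.cons_val_zero, Matrix.cons_val_one, Pi.zero_apply] at e1 e2
    have h1 := (mul_eq_zero.1 e1).resolve_left hk0
    have h2 := (mul_eq_zero.1 e2).resolve_left hk0
    exact h0 ⟨by linarith, by linarith, h'.2⟩

lemma maxZerosEq_G4_three {k : ℝ} (hk : k ∈ Set.Ioc (1 : ℝ) (3 / 2) ∪ Set.Ici 2) :
    MaxZerosEq (G4 k) 3 := by
  have hk1 : k ≠ 1 := by
    rintro rfl
    norm_num at hk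
  refine maxZerosEq_of_upper (fun _ _ => rfl) (analyticAt_G4 k) fun c hc => ?_
  refine zerosLE_G4 (N := 0) hk1 (zerosLE_zero_of_ne_zero fun x => ?_) hc
  -- The coefficients simplify to `(k - 2)(2k - 1)` and `k (2k - 3)`. Here they never have opposite
  -- signs, and at most one of them is zero.
  simp only [Fin.prod_univ_two, Matrix.cons_val_zero, Matrix.cons_val_one]
  rcases hk with ⟨h1, h2⟩ | h
  · have e1 : (k - 2) * ((-1 - 0) * (-1 - (2 * k - 2))) < 0 :=
      mul_neg_of_neg_of_pos (by linarith) (by linarith)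
    have e2 : -k * ((2 * k - 3 - 0) * (2 * k - 3 - (2 * k - 2))) ≤ 0 :=
      mul_nonpos_of_nonpos_of_nonneg (by linarith) (by linarith)
    exact (add_neg_of_neg_of_nonpos (mul_neg_of_neg_of_pos e1 (Real.exp_pos _))
      (mul_nonpos_of_nonpos_of_nonneg e2 (Real.exp_pos _).le)).ne
  · rw [Set.mem_Ici] at h
    have e1 : 0 ≤ (k - 2) * ((-1 - 0) * (-1 - (2 * k - 2))) :=
      mul_nonneg (by linarith) (by linarith)
    have e2 : 0 < -k * ((2 * k - 3 - 0) * (2 * k - 3 - (2 * k - 2))) :=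
      mul_pos_of_neg_of_neg (by linarith) (by linarith)
    exact (add_pos_of_nonneg_of_pos (mul_nonneg e1 (Real.exp_pos _).le)
      (mul_pos e2 (Real.exp_pos _))).ne'

lemma maxZerosEq_G4_four {k : ℝ} (hk : k ∈ Set.Ioo (0 : ℝ) (1 / 2) ∪ Set.Ioo (3 / 2) 2) :
    MaxZerosEq (G4 k) 4 := by
  have hk1 : k ≠ 1 := by
    rintro rfl
    norm_num at hk
  have huw : -1 ≠ 2 * k - 3 := by
    intro h
    exact hk1 (by linarith)
  have hsign : (k - 2) * (∏ i, (-1 - ![0, 2 * k - 2] i)) *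
      (-k * (∏ i, (2 * k - 3 - ![0, 2 * k - 2] i))) < 0 := by
    -- On both intervals `(k - 2)(2k - 1)` and `k (2k - 3)` have opposite signs.
    simp only [Fin.prod_univ_two, Matrix.cons_val_zero, Matrix.cons_val_one]
    rcases hk with ⟨h1, h2⟩ | ⟨h1, h2⟩
    · exact mul_neg_of_pos_of_neg (mul_pos_of_neg_of_neg (by linarith) (by linarith))
        (mul_neg_of_neg_of_pos (by linarith) (by linarith))
    · exact mul_neg_of_neg_of_pos (mul_neg_of_neg_of_pos (by linarith) (by linarith))
        (mul_pos_of_neg_of_neg (by linarith) (by linarith))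
  obtain ⟨t, ht⟩ := exists_exp_add_exp_eq_zero huw hsign
  refine maxZerosEq_of_reduces (fun _ _ => rfl) (analyticAt_G4 k)
    (fun c hc => zerosLE_G4 (N := 1) hk1
      (zerosLE_one_of_exp huw (Or.inl (left_ne_zero_of_mul hsign.ne))) hc) (t := t)
    (H := fun c x => c 3 * ((k - 2) * (∏ i, (-1 - ![0, 2 * k - 2] i)) * Real.exp (-1 * x) +
        (-k) * (∏ i, (2 * k - 3 - ![0, 2 * k - 2] i)) * Real.exp ((2 * k - 3) * x)))
    (fun c => ?_) (fun c => by fun_prop) (fun c => by rw [ht, mul_zero])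
  rw [G4_sum]
  exact (reduces_arctan k _ _ _ _).trans (Reduces.expSum_add _ _ _ _ _ _ _)

/-! ### The families `G6` and `G7` -/

lemma G6_sum (c : Fin 5 → ℝ) :
    (fun t => ∑ j, c j * G6 2 j (Real.exp t)) =
      fun t => c 0 * Real.exp t ^ 4 + c 1 + c 2 * Real.exp t ^ 2 +
        (1 + Real.exp t ^ 2) * (Real.exp t + 2 * Real.exp t ^ 3) *
          (c 3 + c 4 * Real.arctan (Real.exp t)) := by
  funext t
  have h4 : Real.exp t ^ (3 * 2 - 2 : ℝ) = Real.exp t ^ 4 := by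
    rw [← Real.rpow_natCast]; norm_num
  have h3 : Real.exp t ^ (2 * 2 - 1 : ℝ) = Real.exp t ^ 3 := by
    rw [← Real.rpow_natCast]; norm_num
  have h2 : Real.exp t ^ (2 * 2 - 2 : ℝ) = Real.exp t ^ 2 := by
    rw [← Real.rpow_natCast]; norm_num
  have h1 : Real.exp t ^ (2 - 1 : ℝ) = Real.exp t := by norm_num
  have h0 : Real.exp t ^ (2 : ℝ) = Real.exp t ^ 2 := by
    rw [← Real.rpow_natCast]; norm_num
  simp only [Fin.sum_univ_five, G6, u6, u0, u1, u10, u12, Matrix.cons_val, h0, h1, h2, h3, h4]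
  ring

lemma analyticAt_G6 (j : Fin 5) (t : ℝ) :
    AnalyticAt ℝ (fun t => G6 2 j (Real.exp t)) t := by
  have h := analyticAt_arctan_exp (2 - 1) t
  fin_cases j <;> simp [G6, u6, u0, u1, u10, u12, exp_rpow] <;> fun_prop

/-- The coefficients, as a polynomial in `x ^ 2`, of the numerator of the derivative of the
quotient by `u10` of a member of `G6`. -/
def numG6 (c : Fin 5 → ℝ) : Fin 5 → ℝ :=
  ![-c 1, c 4 - 9 * c 1 + c 2, 5 * c 4 - 10 * c 1 - 3 * c 2 + 3 * c 0,
    8 * c 4 - 6 * c 2 + 3 * c 0, 4 * c 4 - 2 * c 0]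

lemma reduces_G6 (c : Fin 5 → ℝ) :
    Reduces 1 (fun t => ∑ j, c j * G6 2 j (Real.exp t))
      (fun t => ∑ i, numG6 c i * Real.exp (2 * t) ^ (i : ℕ)) := by
  rw [G6_sum]
  have hpos : ∀ t, (0 : ℝ) < (1 + Real.exp t ^ 2) * (Real.exp t + 2 * Real.exp t ^ 3) :=
    fun t => by positivity
  have hne := fun t => (hpos t).ne'
  have harc : ∀ x, AnalyticAt ℝ (fun t => Real.arctan (Real.exp t)) x := fun x =>
    (analyticAt_arctan _).fun_comp (by fun_prop)
  set g : ℝ → ℝ := fun t => c 3 + c 4 * Real.arctan (Real.exp t) +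
    (c 0 * Real.exp t ^ 4 + c 1 + c 2 * Real.exp t ^ 2) /
      ((1 + Real.exp t ^ 2) * (Real.exp t + 2 * Real.exp t ^ 3)) with hg
  have hga : ∀ x, AnalyticAt ℝ g x := fun x =>
    (analyticAt_const.add (analyticAt_const.mul (harc x))).add
      (AnalyticAt.div (by fun_prop) (by fun_prop) (hne x))
  refine Reduces.trans (m := 0) (n := 1) (g := g) (Reduces.mul hga
    (u := fun t => (1 + Real.exp t ^ 2) * (Real.exp t + 2 * Real.exp t ^ 3))
    (fun x => by fun_prop) hne fun t => ?_)
    (Reduces.of_hasDerivAt hga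
      (u := fun t => Real.exp t / ((1 + Real.exp t ^ 2) * (Real.exp t + 2 * Real.exp t ^ 3)) ^ 2)
      (fun x => by fun_prop)
      (fun x => AnalyticAt.div (by fun_prop) (by fun_prop) (pow_ne_zero _ (hne x)))
      (fun x => div_ne_zero (Real.exp_pos _).ne' (pow_ne_zero _ (hne x))) fun t => ?_)
  · have h0 := hne t
    rw [hg]
    field_simp
    ring
  · have hE := Real.hasDerivAt_exp t
    have hD := ((hE.arctan.const_mul (c 4)).const_add (c 3)).add
      (((((hE.pow 4).const_mul (c 0)).add_const (c 1)).add ((hE.pow 2).const_mul (c 2))).div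
        (((hE.pow 2).const_add 1).mul (hE.add ((hE.pow 3).const_mul 2))) (hne t))
    refine hD.congr_deriv ?_
    have e : Real.exp (2 * t) = Real.exp t ^ 2 := by
      rw [← Real.exp_nat_mul]
      push_cast
      ring_nf
    have h1 : 1 + Real.exp t ^ 2 ≠ 0 := by positivity
    have h2 : 1 + 2 * Real.exp t ^ 2 ≠ 0 := by positivity
    have h3 : Real.exp t ≠ 0 := by positivity
    simp only [Fin.sum_univ_five, numG6, Matrix.cons_val, e, Pi.pow_apply, Pi.add_apply,
      Pi.mul_apply]
    generalize Real.exp t = T at *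
    have h4 : T + 2 * T ^ 3 = T * (1 + 2 * T ^ 2) := by ring
    rw [h4]
    field_simp
    norm_num
    ring

lemma maxZerosEq_G6 : MaxZerosEq (G6 2) 4 := by
  refine maxZerosEq_of_upper (fun _ _ => rfl) analyticAt_G6 fun c hc => ?_
  -- The numerator vanishes only for multiples of `u10`, which have no zeros.
  by_cases h : numG6 c = 0
  · have e : ∀ i, numG6 c i = 0 := fun i => congrFun h i
    have e0 := e 0
    have e1 := e 1
    have e2 := e 2
    have e3 := e 3
    have e4 := e 4
    simp only [numG6, Matrix.cons_val] at e0 e1 e2 e3 e4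
    have c1 : c 1 = 0 := by linarith
    have c4 : c 4 = 0 := by linarith
    have c0 : c 0 = 0 := by linarith
    have c2 : c 2 = 0 := by linarith
    have c3 : c 3 ≠ 0 := by
      intro c3
      refine hc (funext fun i => ?_)
      fin_cases i <;> simp [c0, c1, c2, c3, c4]
    rw [G6_sum]
    simp only [c0, c1, c2, c4, zero_mul, zero_add, add_zero]
    exact (zerosLE_zero_of_ne_zero fun t => mul_ne_zero (by positivity) c3).mono (Nat.zero_le _)
  -- The five coefficients depend injectively on the four parameters `c 0`, `c 1`, `c 2`, `c 4`, so
  -- they fill a hyperplane; `l` is its normal vector, unique up to scaling. It alternates in sign,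
  -- so the quartic has at most three positive roots.
  · refine (reduces_G6 c).zerosLE 3 (zerosLE_sum_exp_pow (n := 3) (l := ![16, -24, 20, -14, 9])
      h (fun i => ?_) ?_ two_ne_zero)
    · fin_cases i <;> norm_num [Fin.val_ofNat]
    · refine (Fin.sum_univ_five _).trans ?_
      simp only [numG6, Matrix.cons_val]
      ring

lemma G7_sum (c : Fin 6 → ℝ) :
    (fun t => ∑ j, c j * G7 (2 / 3) j (Real.exp t)) =
      fun t => c 0 * (Real.exp (1 / 3 * t) ^ 2)⁻¹ + c 1 + c 2 * (Real.exp (1 / 3 * t) ^ 4)⁻¹ +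
        c 3 * Real.exp (1 / 3 * t) ^ 2 +
        (1 + (Real.exp (1 / 3 * t) ^ 2)⁻¹) *
          (Real.exp (1 / 3 * t) ^ 3 + 2 / 3 * Real.exp (1 / 3 * t)) *
          (c 4 + c 5 * Real.arctan (Real.exp (1 / 3 * t))⁻¹) := by
  funext t
  have e5 : Real.exp t ^ (2 * (2 / 3) - 2 : ℝ) = (Real.exp (1 / 3 * t) ^ 2)⁻¹ := by
    rw [exp_rpow, ← Real.exp_nat_mul, ← Real.exp_neg]; push_cast; ring_nf
  have e6 : Real.exp t ^ (3 * (2 / 3) - 2 : ℝ) = 1 := by norm_num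
  have e3 : Real.exp t ^ (2 / 3 - 2 : ℝ) = (Real.exp (1 / 3 * t) ^ 4)⁻¹ := by
    rw [exp_rpow, ← Real.exp_nat_mul, ← Real.exp_neg]; push_cast; ring_nf
  have e1 : Real.exp t ^ (2 / 3 : ℝ) = Real.exp (1 / 3 * t) ^ 2 := by
    rw [exp_rpow, ← Real.exp_nat_mul]; push_cast; ring_nf
  have e2 : Real.exp t ^ (2 * (2 / 3) - 1 : ℝ) = Real.exp (1 / 3 * t) := by
    rw [exp_rpow]; ring_nf
  have e4 : Real.exp t ^ (2 / 3 - 1 : ℝ) = (Real.exp (1 / 3 * t))⁻¹ := by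
    rw [exp_rpow, ← Real.exp_neg]; ring_nf
  have e0 : Real.exp t = Real.exp (1 / 3 * t) ^ 3 := by
    rw [← Real.exp_nat_mul]; push_cast; ring_nf
  simp only [Fin.sum_univ_six, G7, u5, u6, u3, u1, u10, u12, Matrix.cons_val, e1, e2, e3, e4, e5,
    e6]
  rw [e0]
  ring

lemma analyticAt_G7 (j : Fin 6) (t : ℝ) :
    AnalyticAt ℝ (fun t => G7 (2 / 3) j (Real.exp t)) t := by
  have h := analyticAt_arctan_exp (2 / 3 - 1) t
  fin_cases j <;> simp [G7, u5, u6, u3, u1, u10, u12, exp_rpow] <;> fun_prop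

/-- The coefficients, as a polynomial in `x ^ (2 / 3)`, of the numerator of the derivative of the
quotient by `u10` of a member of `G7`. -/
def numG7 (c : Fin 6 → ℝ) : Fin 6 → ℝ :=
  ![-18 * c 2, 3 * (-25 * c 2 - 2 * c 0), 3 * (-21 * c 2 - 15 * c 0 + 2 * c 1) - 4 * c 5,
    3 * (-15 * c 0 - 5 * c 1 + 6 * c 3) - 16 * c 5, 3 * (-9 * c 1 + 5 * c 3) - 21 * c 5,
    -9 * c 3 - 9 * c 5]

lemma reduces_G7 (c : Fin 6 → ℝ) :
    Reduces 1 (fun t => ∑ j, c j * G7 (2 / 3) j (Real.exp t))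
      (fun t => ∑ i, numG7 c i * Real.exp (2 / 3 * t) ^ (i : ℕ)) := by
  rw [G7_sum]
  have hE0 : ∀ t : ℝ, 0 < Real.exp (1 / 3 * t) := fun t => Real.exp_pos _
  have hpos : ∀ t, (0 : ℝ) < Real.exp (1 / 3 * t) ^ 3 * ((1 + Real.exp (1 / 3 * t) ^ 2) *
      (3 * Real.exp (1 / 3 * t) ^ 2 + 2)) := fun t => by positivity
  have hne := fun t => (hpos t).ne'
  have hpow : ∀ x n, Real.exp (1 / 3 * x) ^ n ≠ 0 := fun x n => pow_ne_zero _ (hE0 x).ne'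
  have harc : ∀ x, AnalyticAt ℝ (fun t => Real.arctan (Real.exp (1 / 3 * t))⁻¹) x := fun x =>
    (analyticAt_arctan _).fun_comp (AnalyticAt.inv (by fun_prop) (hE0 x).ne')
  -- This is the quotient by `u10`, with the negative powers of `exp (t / 3)` and the fraction `2 /
  -- 3` cleared.
  set g : ℝ → ℝ := fun t => c 4 + c 5 * Real.arctan (Real.exp (1 / 3 * t))⁻¹ +
    3 * (c 2 + c 0 * Real.exp (1 / 3 * t) ^ 2 + c 1 * Real.exp (1 / 3 * t) ^ 4 +
      c 3 * Real.exp (1 / 3 * t) ^ 6) /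
      (Real.exp (1 / 3 * t) ^ 3 * ((1 + Real.exp (1 / 3 * t) ^ 2) *
      (3 * Real.exp (1 / 3 * t) ^ 2 + 2))) with hg
  have hga : ∀ x, AnalyticAt ℝ g x := fun x =>
    (analyticAt_const.add (analyticAt_const.mul (harc x))).add
      (AnalyticAt.div (by fun_prop) (by fun_prop) (hne x))
  refine Reduces.trans (m := 0) (n := 1) (g := g) (Reduces.mul hga
    (u := fun t : ℝ => (1 + (Real.exp (1 / 3 * t) ^ 2)⁻¹) *
          (Real.exp (1 / 3 * t) ^ 3 + 2 / 3 * Real.exp (1 / 3 * t)))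
    (fun x => AnalyticAt.mul (AnalyticAt.add analyticAt_const
      (AnalyticAt.inv (f := fun t => Real.exp (1 / 3 * t) ^ 2) (by fun_prop) (hpow x 2)))
      (by fun_prop)) (fun t => by have := hE0 t; positivity) fun t => ?_)
    (Reduces.of_hasDerivAt hga
      (u := fun t => 1 / 3 * Real.exp (1 / 3 * t) ^ 3 / (Real.exp (1 / 3 * t) ^ 3 *
        ((1 + Real.exp (1 / 3 * t) ^ 2) * (3 * Real.exp (1 / 3 * t) ^ 2 + 2))) ^ 2)
      (fun x => by fun_prop)
      (fun x => AnalyticAt.div (by fun_prop) (by fun_prop) (pow_ne_zero _ (hne x)))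
      (fun x => div_ne_zero (mul_ne_zero (by norm_num) (hpow x 3)) (pow_ne_zero _ (hne x)))
      fun t => ?_)
  · have h1 := (hE0 t).ne'
    simp only [hg]
    generalize Real.exp (1 / 3 * t) = E at *
    have h2 : 1 + E ^ 2 ≠ 0 := by positivity
    have h3 : 3 * E ^ 2 + 2 ≠ 0 := by positivity
    field_simp
    ring
  · have hE : HasDerivAt (fun t => Real.exp (1 / 3 * t))
        (Real.exp (1 / 3 * t) * (1 / 3)) t := by
      simpa using ((hasDerivAt_id t).const_mul (1 / 3 : ℝ)).exp
    have h1 := (hE0 t).ne'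
    have hD := (((hE.fun_inv h1).arctan.const_mul (c 5)).const_add (c 4)).add
      (((((((hE.pow 2).const_mul (c 0)).const_add (c 2)).add ((hE.pow 4).const_mul (c 1))).add
        ((hE.pow 6).const_mul (c 3))).const_mul 3).div
        ((hE.pow 3).mul (((hE.pow 2).const_add 1).mul
          (((hE.pow 2).const_mul 3).add_const 2))) (hne t))
    refine hD.congr_deriv ?_
    have e : Real.exp (2 / 3 * t) = Real.exp (1 / 3 * t) ^ 2 := by
      rw [← Real.exp_nat_mul]
      push_cast
      ring_nf
    simp only [Fin.sum_univ_six, numG7, Matrix.cons_val, e, Pi.pow_apply, Pi.add_apply,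
      Pi.mul_apply]
    generalize Real.exp (1 / 3 * t) = E at *
    have h2 : 1 + E ^ 2 ≠ 0 := by positivity
    have h3 : 3 * E ^ 2 + 2 ≠ 0 := by positivity
    have h4 : 1 + (E⁻¹) ^ 2 = (1 + E ^ 2) / E ^ 2 := by
      field_simp
      ring
    rw [h4]
    field_simp
    norm_num
    ring

lemma maxZerosEq_G7 : MaxZerosEq (G7 (2 / 3)) 5 := by
  refine maxZerosEq_of_upper (fun _ _ => rfl) analyticAt_G7 fun c hc => ?_
  by_cases h : numG7 c = 0
  · have e : ∀ i, numG7 c i = 0 := fun i => congrFun h i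
    have e0 := e 0
    have e1 := e 1
    have e2 := e 2
    have e3 := e 3
    have e4 := e 4
    have e5 := e 5
    simp only [numG7, Matrix.cons_val] at e0 e1 e2 e3 e4 e5
    have c2 : c 2 = 0 := by linarith
    have c0 : c 0 = 0 := by linarith
    have c5 : c 5 = 0 := by linarith
    have c1 : c 1 = 0 := by linarith
    have c3 : c 3 = 0 := by linarith
    have c4 : c 4 ≠ 0 := by
      intro c4
      refine hc (funext fun i => ?_)
      fin_cases i <;> simp [c0, c1, c2, c3, c4, c5]
    rw [G7_sum]
    simp only [c0, c1, c2, c3, c5, zero_mul, zero_add, add_zero]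
    exact (zerosLE_zero_of_ne_zero fun t => mul_ne_zero (by positivity) c4).mono (Nat.zero_le _)
  -- Again `l` is normal to the hyperplane of the six coefficients in five parameters; its
  -- alternating signs exclude five positive roots of the quintic.
  · refine (reduces_G7 c).zerosLE 4 (zerosLE_sum_exp_pow (n := 4)
      (l := ![729, -810, 756, -648, 528, -416]) h (fun i => ?_) ?_ (by norm_num))
    · fin_cases i <;> norm_num [Fin.val_ofNat]
    · refine (Fin.sum_univ_six _).trans ?_
      simp only [numG7, Matrix.cons_val]
      ring

end ChebyshevFamilies

end

theorem proposition5 :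
    (∀ k : ℝ, 0 < k → ChebyshevFamilies.MaxZerosEq (ChebyshevFamilies.G0 k) 0) ∧
    (∀ k : ℝ, 0 < k → ChebyshevFamilies.MaxZerosEq (ChebyshevFamilies.G1 k) 1) ∧
    (∀ k : ℝ, k ≠ 1 → ChebyshevFamilies.MaxZerosEq (ChebyshevFamilies.G2 k) 2) ∧
    (∀ k ∈ Set.Ioc (1 : ℝ) 2, ChebyshevFamilies.MaxZerosEq (ChebyshevFamilies.G3 k) 2) ∧
    (∀ k ∈ Set.Ioi (2 : ℝ), ChebyshevFamilies.MaxZerosEq (ChebyshevFamilies.G3 k) 3) ∧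
    (∀ k ∈ Set.Ioc (1 : ℝ) (3 / 2) ∪ Set.Ici 2,
      ChebyshevFamilies.MaxZerosEq (ChebyshevFamilies.G4 k) 3) ∧
    (∀ k ∈ Set.Ioo (0 : ℝ) (1 / 2) ∪ Set.Ioo (3 / 2) 2,
      ChebyshevFamilies.MaxZerosEq (ChebyshevFamilies.G4 k) 4) ∧
    (∀ k ∈ Set.Ico (4 / 3 : ℝ) (3 / 2) ∪ Set.Ioi 2,
      ChebyshevFamilies.MaxZerosEq (ChebyshevFamilies.G5 k) 7) ∧
    (∀ k ∈ Set.Ioo (1 : ℝ) (4 / 3) ∪ Set.Ioo (3 / 2) 2,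
      ChebyshevFamilies.MaxZerosEq (ChebyshevFamilies.G5 k) 8) ∧
    (∀ k : ℝ, k = 2 → ChebyshevFamilies.MaxZerosEq (ChebyshevFamilies.G6 k) 4) ∧
    (∀ k : ℝ, k = 2 / 3 → ChebyshevFamilies.MaxZerosEq (ChebyshevFamilies.G7 k) 5) ∧
    (∀ k : ℝ, 0 < k → ChebyshevFamilies.MaxZerosEq (ChebyshevFamilies.G10 k) 2) ∧
    (∀ k : ℝ, k = 1 → ChebyshevFamilies.MaxZerosEq (ChebyshevFamilies.G11 k) 1) := by
  open ChebyshevFamilies in exact ⟨fun k _ => maxZerosEq_G0 k, fun _ => maxZerosEq_G1, fun _ => maxZerosEq_G2,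
    fun _ => maxZerosEq_G3_two, fun _ => maxZerosEq_G3_three, fun _ => maxZerosEq_G4_three,
    fun _ => maxZerosEq_G4_four, fun _ => maxZerosEq_G5_seven, fun _ => maxZerosEq_G5_eight,
    fun _ h => h ▸ maxZerosEq_G6, fun _ h => h ▸ maxZerosEq_G7, fun _ => maxZerosEq_G10,
    fun _ h => h ▸ maxZerosEq_G11⟩
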